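/- Consider the structure of the integers with constants, addition, the order $<$ and the congruences $s\equiv_k t$ ($k\ge 1$). Terms are built from variables and integer constants by addition and by multiplication with integers. Let $\mathrm{FO}[\exists^{(q,p)}x]$ be the logic built from the atomic formulas $s<t$ and $s\equiv_k t$ by $\lnot,\land,\lor,\to,\leftrightarrow$, by $\exists y$, and by the modulo-counting quantifiers $\exists^{(q,p)}y$ ($q\in\mathbb N$, $p\ge 2$), where $\exists^{(q,p)}y\colon\varphi$ says that the set of witnesses $y\in\mathbb Z$ for $\varphi$ is finite and its cardinality is congruent to $q$ modulo $p$. For a formula $\varphi$ let $\mathrm{Coeff}(\varphi)$ (resp. $\mathrm{Const}(\varphi)$) consist of $0,\pm1,\pm2$ and of $\pm a$ for all coefficients of variables (resp. constants) $a$ in the normal forms $a_1x_{i_1}+\dots+a_mx_{i_m}+c$ of the terms $s-t$, for atomic formulas $s<t$ in $\varphi$. Let $\mathrm{Mod}(\varphi)$ consist of $1$, all $k$ such that some $s\equiv_k t$ occurs in $\varphi$, and all $p$ such that some $\exists^{(q,p)}$ occurs in $\varphi$; put $\mathbf P(\varphi)=\mathrm{Coeff}(\varphi)\cup\mathrm{Mod}(\varphi)$.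 **Corollary C2.** There is an integer $\kappa\ge2$ such that the following holds for all $d\ge1$, all formulas $\varphi(x,y_1,\dots,y_\ell)$ of $\mathrm{FO}[\exists^{(q,p)}x]$ of quantifier depth at most $d$ (with $\ell\ge0$, distinct variables $x,y_1,\dots,y_\ell$, and all free variables of $\varphi$ among them), all integers $N\ge1$, and all $n_1,\dots,n_\ell\in\mathbb Z$ with $|n_i|\le N$. 1. (The defining property of $\kappa$.) $\exists x\colon\varphi(x,n_1,\dots,n_\ell)$ is true if and only if $\varphi(n,n_1,\dots,n_\ell)$ is true for some $n\in\mathbb Z$ with $$|n|\le 2^{\max\mathbf P(\varphi)^{\kappa^{d}}}\cdot\max\mathrm{Const}(\varphi)\cdot N\cdot\max\{1,\ell\}.$$ 2. For all $q\in\mathbb N$ and $p\ge2$, with $$C=2^{\max\mathbf P(\varphi)^{\kappa^{d+1}}}\cdot\max\mathrm{Const}(\varphi)\cdot N\cdot\max\{1,\ell\},$$ the sentence $\exists^{(q,p)}x\colon\varphi(x,n_1,\dots,n_\ell)$ is true if and only if (a) no integer $n$ with $C<|n|\le C^2$ makes $\varphi(n,n_1,\dots,n_\ell)$ true, and (b)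 $\bigl|\{n\in\mathbb Z : |n|\le C \text{ and } \varphi(n,n_1,\dots,n_\ell)\text{ is true}\}\bigr|\equiv q \pmod p$. -/

import Mathlib

namespace ModCount

/-- Terms over the variables `x_i` (represented by their index `i : ℕ`), integer constants,
multiplication by an integer, and addition. -/
inductive Term : Type
  | var (i : ℕ) : Term
  | const (c : ℤ) : Term
  | smul (a : ℤ) (t : Term) : Term
  | add (s t : Term) : Term

namespace Term

/-- The value of a term under an assignment `f`. -/
def eval (f : ℕ → ℤ) : Term → ℤ
  | var i => f i
  | const c => c
  | smul a t => a * t.eval f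
  | add s t => s.eval f + t.eval f

/-- The term `s - t`, i.e. `s + (-1) t`. -/
def sub (s t : Term) : Term := add s (smul (-1) t)

/-- The variables occurring in a term. -/
def vars : Term → Finset ℕ
  | var i => {i}
  | const _ => ∅
  | smul _ t => t.vars
  | add s t => s.vars ∪ t.vars

/-- The coefficient of `x_j` in the normal form `a₁ x_{i₁} + ⋯ + aₙ x_{iₙ} + c` of a term
(`0` if `x_j` is absent from the normal form). -/
def coeff (j : ℕ) : Term → ℤ
  | var i => if i = j then 1 else 0
  | const _ => 0
  | smul a t => a * t.coeff j
  | add s t => s.coeff j + t.coeff j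

/-- The constant `c` in the normal form of a term. -/
def constPart : Term → ℤ
  | var _ => 0
  | const c => c
  | smul a t => a * t.constPart
  | add s t => s.constPart + t.constPart

end Term

/-- Formulas of first-order logic over `(ℤ, +, <, (≡_k)_k, constants)` extended by the unary
modulo-counting quantifiers `∃^{(q,p)} y` with constant residue `q : ℕ` and modulus `p ≥ 2`. -/
inductive Formula : Type
  | lt (s t : Term) : Formula
  | cong (k : ℕ) (hk : 1 ≤ k) (s t : Term) : Formula
  | neg (φ : Formula) : Formula
  | conj (φ ψ : Formula) : Formula
  | disj (φ ψ : Formula) : Formula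
  | imp (φ ψ : Formula) : Formula
  | equiv (φ ψ : Formula) : Formula
  | ex (y : ℕ) (φ : Formula) : Formula
  | exMod (q p : ℕ) (hp : 2 ≤ p) (y : ℕ) (φ : Formula) : Formula

namespace Formula

/-- Truth of a formula under an assignment; `∃^{(q,p)} y φ` says that the set of witnesses is
finite and that its cardinality is congruent to `q` modulo `p`. -/
def Sat : Formula → (ℕ → ℤ) → Prop
  | lt s t, f => s.eval f < t.eval f
  | cong k _ s t, f => (k : ℤ) ∣ s.eval f - t.eval f
  | neg φ, f => ¬ φ.Sat f
  | conj φ ψ, f => φ.Sat f ∧ ψ.Sat f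
  | disj φ ψ, f => φ.Sat f ∨ ψ.Sat f
  | imp φ ψ, f => φ.Sat f → ψ.Sat f
  | equiv φ ψ, f => (φ.Sat f ↔ ψ.Sat f)
  | ex y φ, f => ∃ a : ℤ, φ.Sat (Function.update f y a)
  | exMod q p _ y φ, f =>
      {a : ℤ | φ.Sat (Function.update f y a)}.Finite ∧
        {a : ℤ | φ.Sat (Function.update f y a)}.ncard ≡ q [MOD p]

/-- The free variables of a formula. -/
def freeVars : Formula → Finset ℕ
  | lt s t => s.vars ∪ t.vars
  | cong _ _ s t => s.vars ∪ t.vars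
  | neg φ => φ.freeVars
  | conj φ ψ => φ.freeVars ∪ ψ.freeVars
  | disj φ ψ => φ.freeVars ∪ ψ.freeVars
  | imp φ ψ => φ.freeVars ∪ ψ.freeVars
  | equiv φ ψ => φ.freeVars ∪ ψ.freeVars
  | ex y φ => φ.freeVars.erase y
  | exMod _ _ _ y φ => φ.freeVars.erase y

/-- The quantifier depth of a formula. -/
def qd : Formula → ℕ
  | lt _ _ => 0
  | cong _ _ _ _ => 0
  | neg φ => φ.qd
  | conj φ ψ => max φ.qd ψ.qd
  | disj φ ψ => max φ.qd ψ.qd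
  | imp φ ψ => max φ.qd ψ.qd
  | equiv φ ψ => max φ.qd ψ.qd
  | ex _ φ => 1 + φ.qd
  | exMod _ _ _ _ φ => 1 + φ.qd

/-- `0`, `±1`, `±2`, and `±a` for the coefficients `a` of the terms `s - t`, where `s < t` is an
atomic formula occurring in the formula. -/
def coeffs : Formula → Finset ℤ
  | lt s t =>
      {0, 1, -1, 2, -2} ∪ (s.sub t).vars.image (fun j => (s.sub t).coeff j) ∪
        (s.sub t).vars.image (fun j => -(s.sub t).coeff j)
  | cong _ _ _ _ => {0, 1, -1, 2, -2}
  | neg φ => φ.coeffs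
  | conj φ ψ => φ.coeffs ∪ ψ.coeffs
  | disj φ ψ => φ.coeffs ∪ ψ.coeffs
  | imp φ ψ => φ.coeffs ∪ ψ.coeffs
  | equiv φ ψ => φ.coeffs ∪ ψ.coeffs
  | ex _ φ => φ.coeffs
  | exMod _ _ _ _ φ => φ.coeffs

/-- `0`, `±1`, `±2`, and `±c` for the constants `c` of the terms `s - t`, where `s < t` is an
atomic formula occurring in the formula. -/
def consts : Formula → Finset ℤ
  | lt s t => {0, 1, -1, 2, -2, (s.sub t).constPart, -(s.sub t).constPart}
  | cong _ _ _ _ => {0, 1, -1, 2, -2}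
  | neg φ => φ.consts
  | conj φ ψ => φ.consts ∪ ψ.consts
  | disj φ ψ => φ.consts ∪ ψ.consts
  | imp φ ψ => φ.consts ∪ ψ.consts
  | equiv φ ψ => φ.consts ∪ ψ.consts
  | ex _ φ => φ.consts
  | exMod _ _ _ _ φ => φ.consts

/-- `1`, the moduli `k` of the atomic formulas `s ≡_k t`, and the moduli `p` of the quantifiers
`∃^{(q,p)}` occurring in the formula. -/
def moduli : Formula → Finset ℕ
  | lt _ _ => {1}
  | cong k _ _ _ => {1, k}
  | neg φ => φ.moduli
  | conj φ ψ => φ.moduli ∪ ψ.moduli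
  | disj φ ψ => φ.moduli ∪ ψ.moduli
  | imp φ ψ => φ.moduli ∪ ψ.moduli
  | equiv φ ψ => φ.moduli ∪ ψ.moduli
  | ex _ φ => φ.moduli
  | exMod _ p _ _ φ => insert p φ.moduli

/-- The union of the set of coefficients and the set of moduli. -/
def params (φ : Formula) : Finset ℤ := φ.coeffs ∪ φ.moduli.image (fun k : ℕ => (k : ℤ))

/-- The maximum of `params φ`, as a natural number (see `isGreatest_maxParam`). -/
def maxParam (φ : Formula) : ℕ := φ.params.sup Int.toNat

/-- The maximum of `consts φ`, as a natural number (see `isGreatest_maxConst`). -/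
def maxConst (φ : Formula) : ℕ := φ.consts.sup Int.toNat

theorem zero_mem_coeffs (φ : Formula) : (0 : ℤ) ∈ φ.coeffs := by
  induction φ <;> simp_all [coeffs]

theorem zero_mem_consts (φ : Formula) : (0 : ℤ) ∈ φ.consts := by
  induction φ <;> simp_all [consts]

theorem isGreatest_sup_toNat (S : Finset ℤ) (h : (0 : ℤ) ∈ S) :
    IsGreatest (S : Set ℤ) ((S.sup Int.toNat : ℕ) : ℤ) := by
  constructor
  · obtain ⟨a, ha, hs⟩ := Finset.exists_mem_eq_sup S ⟨0, h⟩ Int.toNat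
    rw [hs]
    rcases le_total 0 a with h0 | h0
    · rwa [Int.toNat_of_nonneg h0]
    · rwa [Int.toNat_of_nonpos h0]
  · intro a ha
    have h1 : a.toNat ≤ S.sup Int.toNat := Finset.le_sup (f := Int.toNat) ha
    omega

theorem isGreatest_maxParam (φ : Formula) : IsGreatest (φ.params : Set ℤ) (φ.maxParam : ℤ) :=
  isGreatest_sup_toNat _ (Finset.mem_union_left _ φ.zero_mem_coeffs)

theorem isGreatest_maxConst (φ : Formula) : IsGreatest (φ.consts : Set ℤ) (φ.maxConst : ℤ) :=
  isGreatest_sup_toNat _ φ.zero_mem_consts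

/-- The bound `2 ^ (max P(φ) ^ (κ ^ e)) · max Const(φ) · N · max {1, ℓ}`. -/
def bound (φ : Formula) (κ e N l : ℕ) : ℕ :=
  2 ^ (φ.maxParam ^ (κ ^ e)) * φ.maxConst * N * max 1 l

end Formula

end ModCount

/-! Call two assignments similar if they agree modulo `M` on the relevant variables and give the
same sign to every linear form with coefficients at most `A` and constant at most `B` in absolute
value. An Ehrenfeucht–Fraïssé style induction (`determined_sat`) shows that similarity determines
truth, with `A`, `B`, `M` growing with the quantifier depth.

The quantifier step is `countEq_of_similar`. The inequalities on the quantified variable are given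
by finitely many thresholds; together with the residues modulo `M` they cut the integers into cells
on which the truth value is constant. For two assignments similar with larger parameters,
corresponding thresholds are congruent modulo `p * M` and their order and gaps agree up to `M`. So
corresponding cells agree in emptiness, finiteness and cardinality modulo `p` (`countEq_position`).

With the other variables fixed, any two values of `x` beyond some `T`, congruent modulo `M` and on
the same side of 0, give similar assignments. Hence the witness set is periodic there: a witness
beyond `T` forces infinitely many, and one in each further window of length `M` on its side. Both
claims follow for every `C ≥ T + M` (with `C ≥ 2` for the second), and `period_le_bound` estimates
`T + M`. -/

namespace ModCount

/-! ### Witness sets that the quantifiers cannot tell apart -/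

/-- Two sets of integers are indistinguishable by `∃` and by the quantifiers `∃^{(q,p)}`. -/
structure CountEq (p : ℕ) (S S' : Set ℤ) : Prop where
  nonempty : S.Nonempty ↔ S'.Nonempty
  finite : S.Finite ↔ S'.Finite
  ncard : S.ncard ≡ S'.ncard [MOD p]

namespace CountEq

theorem of_infinite {p : ℕ} {S S' : Set ℤ} (h : S.Infinite) (h' : S'.Infinite) :
    CountEq p S S' where
  nonempty := iff_of_true h.nonempty h'.nonempty
  finite := iff_of_false h h'
  -- Infinite sets have `ncard` 0 by convention.
  ncard := by rw [h.ncard, h'.ncard]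

theorem union {p : ℕ} {S S' T T' : Set ℤ} (hS : CountEq p S S') (hT : CountEq p T T')
    (hd : Disjoint S T) (hd' : Disjoint S' T') : CountEq p (S ∪ T) (S' ∪ T') where
  nonempty := by rw [Set.union_nonempty, Set.union_nonempty, hS.nonempty, hT.nonempty]
  finite := by rw [Set.finite_union, Set.finite_union, hS.finite, hT.finite]
  ncard := by
    by_cases h : (S ∪ T).Finite
    · have h' : (S' ∪ T').Finite := by
        rwa [Set.finite_union, ← hS.finite, ← hT.finite, ← Set.finite_union]
      rw [Set.finite_union] at h h'
      rw [Set.ncard_union_eq hd h.1 h.2, Set.ncard_union_eq hd' h'.1 h'.2]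
      exact hS.ncard.add hT.ncard
    · have h' : ¬ (S' ∪ T').Finite := by
        rwa [Set.finite_union, ← hS.finite, ← hT.finite, ← Set.finite_union]
      rw [Set.Infinite.ncard h, Set.Infinite.ncard h']

theorem preimage {X : Type*} [Finite X] {p : ℕ} {τ τ' : ℤ → X}
    (h : ∀ k, CountEq p (τ ⁻¹' {k}) (τ' ⁻¹' {k})) (K : Set X) :
    CountEq p (τ ⁻¹' K) (τ' ⁻¹' K) := by
  induction K, K.toFinite using Set.Finite.induction_on with
  | empty => exact ⟨by simp, by simp, by simpa using Nat.ModEq.rfl⟩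
  | @insert k K hk _ ih =>
    rw [Set.insert_eq, Set.preimage_union, Set.preimage_union]
    have hd : Disjoint {k} K := by simpa using hk
    exact (h k).union ih (hd.preimage τ) (hd.preimage τ')

/-- Sets that correspond to each other under classifications of the integers with equivalent
classes are equivalent. -/
theorem of_classes {X : Type*} [Finite X] {p : ℕ} {τ τ' : ℤ → X} {S S' : Set ℤ}
    (h : ∀ k, CountEq p (τ ⁻¹' {k}) (τ' ⁻¹' {k}))
    (hS : ∀ a a', τ a = τ' a' → (a ∈ S ↔ a' ∈ S')) : CountEq p S S' := by
  have e : S = τ ⁻¹' (τ '' S) := by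
    refine (Set.subset_preimage_image τ S).antisymm ?_
    rintro a ⟨b, hb, hab⟩
    -- Two elements of one class are compared through a partner on the primed side, so each class
    -- lies inside `S` or outside it.
    obtain ⟨a', ha'⟩ := (h (τ a)).nonempty.1 ⟨a, rfl⟩
    have ha'' : τ' a' = τ a := ha'
    exact (hS a a' ha''.symm).2 ((hS b a' (hab.trans ha''.symm)).1 hb)
  have e' : S' = τ' ⁻¹' (τ '' S) := by
    ext a'
    constructor
    · intro ha'
      obtain ⟨a, ha⟩ := (h (τ' a')).nonempty.2 ⟨a', rfl⟩
      exact ⟨a, (hS a a' ha).2 ha', ha⟩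
    · rintro ⟨a, ha, haa'⟩
      exact (hS a a' haa').1 ha
  rw [e]
  conv => enter [3]; rw [e']
  exact preimage h _

/-- The count is a difference of ceilings `⌈(b - v) / M⌉ - ⌈(a - v) / M⌉`, truncated at 0, and
moving an endpoint by a multiple of `p * M` changes its ceiling by a multiple of `p`. Emptiness
depends on whether the first member of the class from `a` on, at an offset below `M`, lies before
`b`. -/
theorem Ico_modEq {p M : ℕ} (hM : 0 < M) {a b a' b' : ℤ} (v : ℤ)
    (ha : a ≡ a' [ZMOD (p * M : ℕ)]) (hb : b ≡ b' [ZMOD (p * M : ℕ)])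
    (h : ∀ δ : ℤ, 0 ≤ δ → δ ≤ M → (a + δ ≤ b ↔ a' + δ ≤ b')) :
    CountEq p {y | (a ≤ y ∧ y < b) ∧ y ≡ v [ZMOD M]}
      {y | (a' ≤ y ∧ y < b') ∧ y ≡ v [ZMOD M]} := by
  have hM' : (0 : ℤ) < M := by exact_mod_cast hM
  have key : ∀ a b : ℤ, {y | (a ≤ y ∧ y < b) ∧ y ≡ v [ZMOD M]} =
      (↑({y ∈ Finset.Ico a b | y ≡ v [ZMOD M]}) : Set ℤ) := by
    intro a b; ext y; simp
  have ne : ∀ a b : ℤ, {y | (a ≤ y ∧ y < b) ∧ y ≡ v [ZMOD M]}.Nonempty ↔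
      a + ((v - a) % M + 1) ≤ b := by
    intro a b
    have h0 := Int.emod_nonneg (v - a) hM'.ne'
    have h1 : a + (v - a) % M ≡ v [ZMOD M] := by
      have := (Int.mod_modEq (v - a) M).add_left a
      simpa using this
    constructor
    · rintro ⟨y, ⟨h2, h3⟩, h4⟩
      have h5 : (v - a) % M = (y - a) % M := (h4.symm.sub_right a)
      have h6 := Int.emod_nonneg (y - a) hM'.ne'
      have h7 : (y - a) % M ≤ y - a := by
        have h8 := Int.emod_add_mul_ediv (y - a) M
        have h9 : 0 ≤ (y - a) / M := Int.ediv_nonneg (by omega) hM'.le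
        nlinarith
      omega
    · intro h2
      exact ⟨_, ⟨by omega, by omega⟩, h1⟩
  have haM : a ≡ a' [ZMOD M] := ha.of_mul_left p |> fun h => by simpa using h
  refine ⟨?_, ?_, ?_⟩
  · rw [ne, ne]
    have h1 : (v - a) % M = (v - a') % M := haM.sub_left v
    have h0 := Int.emod_nonneg (v - a) hM'.ne'
    have h2 := Int.emod_lt_of_pos (v - a) hM'
    rw [← h1]
    exact h _ (by omega) (by omega)
  · rw [key, key]
    exact iff_of_true (Finset.finite_toSet _) (Finset.finite_toSet _)
  · rw [key, key, Set.ncard_coe_finset, Set.ncard_coe_finset, ← Int.natCast_modEq_iff,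
      Int.Ico_filter_modEq_card _ _ hM', Int.Ico_filter_modEq_card _ _ hM']
    have hab := h 0 le_rfl hM'.le
    simp only [add_zero] at hab
    have shift : ∀ {a a' : ℤ}, a ≡ a' [ZMOD (p * M : ℕ)] →
        ⌈((a : ℚ) - v) / (M : ℤ)⌉ ≡ ⌈((a' : ℚ) - v) / (M : ℤ)⌉ [ZMOD p] := by
      intro a a' haa
      obtain ⟨k, hk⟩ := haa.dvd
      obtain rfl : a' = a + p * M * k := by push_cast at hk; linarith
      have : (((a + p * M * k : ℤ) : ℚ) - v) / (M : ℤ) = ((a : ℚ) - v) / (M : ℤ) + (p * k : ℤ) := by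
        have : (M : ℚ) ≠ 0 := by exact_mod_cast hM.ne'
        push_cast
        field_simp
        ring
      rw [this, Int.ceil_add_intCast]
      exact (Int.modEq_iff_dvd.2 (by simp))
    have mono : ∀ {a b : ℤ}, a ≤ b → ⌈((a : ℚ) - v) / (M : ℤ)⌉ ≤ ⌈((b : ℚ) - v) / (M : ℤ)⌉ := by
      intro a b hab
      have : (a : ℚ) ≤ b := by exact_mod_cast hab
      apply Int.ceil_mono
      gcongr
    rcases le_total a b with hle | hle
    · rw [max_eq_left (sub_nonneg.2 (mono hle)), max_eq_left (sub_nonneg.2 (mono (hab.1 hle)))]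
      exact (shift hb).sub (shift ha)
    -- The truncation must happen on both sides at once: `δ = 0` and `δ = 1` exclude `a' < b'`.
    · have hle' : b' ≤ a' := by
        by_contra hc
        push Not at hc
        have := hab.2 hc.le
        have e : a = b := le_antisymm this hle
        have := h 1 (by norm_num) (by exact_mod_cast hM)
        omega
      rw [max_eq_right (sub_nonpos.2 (mono hle)), max_eq_right (sub_nonpos.2 (mono hle'))]

end CountEq

/-! ### Cells cut out by thresholds and residues -/

theorem infinite_Ici_modEq {M : ℕ} (hM : 0 < M) (a v : ℤ) :
    {y : ℤ | a ≤ y ∧ y ≡ v [ZMOD M]}.Infinite := by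
  have hM' : (0 : ℤ) < M := by exact_mod_cast hM
  refine Set.infinite_of_not_bddAbove ?_
  rintro ⟨b, hb⟩
  have h := hb (a := v + M * (|a| + |b| + |v| + 1)) ⟨?_, by simp [Int.modEq_iff_dvd]⟩
  all_goals
    have := neg_abs_le v
    have := le_abs_self a
    have := le_abs_self b
    have := abs_nonneg a
    have := abs_nonneg b
    nlinarith [abs_nonneg v]

theorem infinite_Iio_modEq {M : ℕ} (hM : 0 < M) (a v : ℤ) :
    {y : ℤ | y < a ∧ y ≡ v [ZMOD M]}.Infinite := by
  have h := (infinite_Ici_modEq hM (1 - a) (-v)).image (f := fun y : ℤ => -y)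
    neg_injective.injOn
  refine h.mono ?_
  rintro _ ⟨y, ⟨h1, h2⟩, rfl⟩
  exact ⟨by dsimp only; omega, by simpa using h2.neg⟩

/-- The position of `y` relative to the thresholds `h i`, together with its residue. -/
def position {ι : Type*} (h : ι → ℤ) (M : ℕ) (y : ℤ) : Set ι × ZMod M := ({i | h i ≤ y}, (y : ZMod M))

/-- Only the largest lower and the smallest upper threshold bound a cell. By the case `δ = 0` both
families are ordered alike, so the same indices are extremal for `h` and `h'`. -/
theorem countEq_position {ι : Type*} [Finite ι] {p M : ℕ} (hM : 0 < M) {h h' : ι → ℤ}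
    (hmod : ∀ i, h i ≡ h' i [ZMOD (p * M : ℕ)])
    (hle : ∀ i j, ∀ δ : ℤ, 0 ≤ δ → δ ≤ M → (h i + δ ≤ h j ↔ h' i + δ ≤ h' j))
    (k : Set ι × ZMod M) :
    CountEq p (position h M ⁻¹' {k}) (position h' M ⁻¹' {k}) := by
  obtain ⟨c, r⟩ := k
  obtain ⟨v, rfl⟩ := ZMod.intCast_surjective r
  have le_iff : ∀ i j, h i ≤ h j ↔ h' i ≤ h' j := fun i j => by
    simpa using hle i j 0 le_rfl (by positivity)
  have cell : ∀ h : ι → ℤ, position h M ⁻¹' {(c, (v : ZMod M))} =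
      {y | ((∀ i ∈ c, h i ≤ y) ∧ ∀ i ∉ c, y < h i) ∧ y ≡ v [ZMOD M]} := by
    intro h
    ext y
    simp only [position, Set.mem_preimage, Set.mem_singleton_iff, Prod.mk.injEq, Set.ext_iff,
      Set.mem_ofPred_eq, ZMod.intCast_eq_intCast_iff]
    refine and_congr_left fun _ => ⟨fun H => ⟨fun i => (H i).2, fun i hi => ?_⟩, fun H i => ⟨fun hi => ?_, H.1 i⟩⟩
    · exact not_le.1 fun hy => hi ((H i).1 hy)
    · by_contra hc
      exact absurd hi (not_le.2 (H.2 i hc))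
  have lower : c.Nonempty → ∃ i, ∀ g : ι → ℤ, g = h ∨ g = h' → ∀ y,
      ((∀ j ∈ c, g j ≤ y) ↔ g i ≤ y) := by
    intro hc
    obtain ⟨i, hi, hmax⟩ := Set.exists_max_image c h c.toFinite hc
    refine ⟨i, fun g hg y => ⟨fun H => H i hi, fun H j hj => le_trans ?_ H⟩⟩
    rcases hg with rfl | rfl
    · exact hmax j hj
    · exact (le_iff j i).1 (hmax j hj)
  have upper : cᶜ.Nonempty → ∃ i, ∀ g : ι → ℤ, g = h ∨ g = h' → ∀ y,
      ((∀ j ∉ c, y < g j) ↔ y < g i) := by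
    intro hc
    obtain ⟨i, hi, hmin⟩ := Set.exists_min_image cᶜ h cᶜ.toFinite hc
    refine ⟨i, fun g hg y => ⟨fun H => H i hi, fun H j hj => lt_of_lt_of_le H ?_⟩⟩
    rcases hg with rfl | rfl
    · exact hmin j hj
    · exact (le_iff i j).1 (hmin j hj)
  rw [cell, cell]
  rcases c.eq_empty_or_nonempty with hc | hc <;> rcases cᶜ.eq_empty_or_nonempty with hc' | hc'
  · have : IsEmpty ι := by
      rw [← Set.univ_eq_empty_iff, ← hc', hc, Set.compl_empty]
    obtain rfl := Subsingleton.elim h h'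
    exact ⟨Iff.rfl, Iff.rfl, rfl⟩
  · obtain ⟨j, hj⟩ := upper hc'
    have ht : ∀ (g : ι → ℤ) y, (∀ i ∈ c, g i ≤ y) = True := by simp [hc]
    simp only [ht, true_and, hj h (.inl rfl), hj h' (.inr rfl)]
    exact .of_infinite (infinite_Iio_modEq hM _ _) (infinite_Iio_modEq hM _ _)
  · obtain ⟨i, hi⟩ := lower hc
    have ht : ∀ (g : ι → ℤ) y, (∀ i ∉ c, y < g i) = True := by
      simp [Set.compl_empty_iff.1 hc']
    simp only [ht, and_true, hi h (.inl rfl), hi h' (.inr rfl)]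
    exact .of_infinite (infinite_Ici_modEq hM _ _) (infinite_Ici_modEq hM _ _)
  · obtain ⟨i, hi⟩ := lower hc
    obtain ⟨j, hj⟩ := upper hc'
    simp only [hi h (.inl rfl), hi h' (.inr rfl), hj h (.inl rfl), hj h' (.inr rfl)]
    exact .Ico_modEq hM v (hmod i) (hmod j) (hle i j)


/-! ### Linear forms and similar assignments -/

/-- The value at `f` of the linear form with coefficients `α i`, `i ∈ W`, and constant `c`. -/
def linForm (W : Finset ℕ) (α : ℕ → ℤ) (c : ℤ) (f : ℕ → ℤ) : ℤ := ∑ i ∈ W, α i * f i + c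

/-- `f` and `g` agree on `W` modulo `M`, and they give the same sign to all linear forms with
coefficients bounded by `A` and constant bounded by `B`. -/
structure Similar (W : Finset ℕ) (A B M : ℕ) (f g : ℕ → ℤ) : Prop where
  modEq : ∀ i ∈ W, f i ≡ g i [ZMOD M]
  pos : ∀ (α : ℕ → ℤ) (c : ℤ), (∀ i ∈ W, |α i| ≤ A) → |c| ≤ B →
    (0 < linForm W α c f ↔ 0 < linForm W α c g)

/-- The truth of `R` depends only on the `Similar` class of the assignment. -/
def Determined (W : Finset ℕ) (A B M : ℕ) (R : (ℕ → ℤ) → Prop) : Prop :=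
  ∀ f g, Similar W A B M f g → (R f ↔ R g)

namespace Similar

variable {W W' : Finset ℕ} {A B M A' B' M' : ℕ} {f g : ℕ → ℤ}

theorem mono (h : Similar W' A' B' M' f g) (hW : W ⊆ W') (hA : A ≤ A') (hB : B ≤ B')
    (hM : M ∣ M') : Similar W A B M f g where
  modEq i hi := (h.modEq i (hW hi)).of_dvd (Int.natCast_dvd_natCast.2 hM)
  pos α c hα hc := by
    have e : ∀ f, linForm W α c f = linForm W' (fun i => if i ∈ W then α i else 0) c f := by
      intro f
      simp [linForm, Finset.inter_eq_right.2 hW]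
    rw [e, e]
    refine h.pos _ _ (fun i _ => ?_) (hc.trans (by exact_mod_cast hB))
    split_ifs with hi
    · exact (hα i hi).trans (by exact_mod_cast hA)
    · simp

theorem linForm_modEq (h : Similar W A B M f g) (α : ℕ → ℤ) (c : ℤ) :
    linForm W α c f ≡ linForm W α c g [ZMOD M] := by
  refine Int.ModEq.add_right _ ?_
  rw [Int.modEq_iff_dvd, ← Finset.sum_sub_distrib]
  refine Finset.dvd_sum fun i hi => ?_
  rw [← mul_sub]
  exact (h.modEq i hi).dvd.mul_left _

end Similar

theorem linForm_update {W : Finset ℕ} {y : ℕ} (hy : y ∉ W) (α : ℕ → ℤ) (c : ℤ) (f : ℕ → ℤ)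
    (a : ℤ) : linForm (insert y W) α c (Function.update f y a) = α y * a + linForm W α c f := by
  have : ∑ i ∈ W, α i * Function.update f y a i = ∑ i ∈ W, α i * f i :=
    Finset.sum_congr rfl fun i hi => by
      rw [Function.update_of_ne (ne_of_mem_of_not_mem hi hy)]
  rw [linForm, Finset.sum_insert hy, this, Function.update_self, linForm, add_assoc]

/-! ### Solving linear inequalities for one variable -/

/-- The least `a` with `0 < b * a + t`, for positive `b`. -/
def threshold (b t : ℤ) : ℤ := -((t - 1) / b)

theorem threshold_le_iff {b : ℤ} (hb : 0 < b) (t a : ℤ) : threshold b t ≤ a ↔ 0 < b * a + t := by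
  rw [threshold, neg_le, Int.le_ediv_iff_mul_le hb]
  constructor <;> intro h <;> nlinarith

theorem neg_iff_threshold_le {b : ℤ} (hb : 0 < b) (t a : ℤ) :
    0 < -b * a + t ↔ ¬ threshold b (1 - t) ≤ a := by
  rw [threshold_le_iff hb]
  constructor <;> intro h <;> nlinarith

/-- Division by `b` costs a factor `b` of the modulus; this is the source of the factorial of `A` in
the moduli. -/
theorem threshold_modEq {b t t' : ℤ} {m : ℕ} (hb : 0 < b) (h : t ≡ t' [ZMOD b * m]) :
    threshold b t ≡ threshold b t' [ZMOD m] := by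
  obtain ⟨k, hk⟩ := h.dvd
  obtain rfl : t' = t + b * (m * k) := by linarith
  rw [threshold, threshold, show t + b * (m * k) - 1 = t - 1 + b * (m * k) by ring,
    Int.add_mul_ediv_left _ _ hb.ne']
  exact Int.modEq_iff_dvd.2 ⟨-k, by ring⟩

/-- Each quotient is replaced by its exact remainder and the denominators are cleared. Once the
remainders are fixed by congruences, the right side is the sign of one linear form. -/
theorem threshold_add_le_iff {b₁ b₂ : ℤ} (h₁ : 0 < b₁) (h₂ : 0 < b₂) (t₁ t₂ δ : ℤ) :
    threshold b₁ t₁ + δ ≤ threshold b₂ t₂ ↔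
      0 < b₂ * t₁ - b₁ * t₂ +
        (b₁ - b₂ - b₂ * ((t₁ - 1) % b₁) + b₁ * ((t₂ - 1) % b₂) - b₁ * b₂ * δ + 1) := by
  have e₁ := Int.emod_add_mul_ediv (t₁ - 1) b₁
  have e₂ := Int.emod_add_mul_ediv (t₂ - 1) b₂
  have h : 0 < b₁ * b₂ := mul_pos h₁ h₂
  rw [threshold, threshold]
  generalize (t₁ - 1) % b₁ = r₁ at *
  generalize (t₂ - 1) % b₂ = r₂ at *
  generalize (t₁ - 1) / b₁ = q₁ at *
  generalize (t₂ - 1) / b₂ = q₂ at *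
  obtain rfl : t₁ = r₁ + b₁ * q₁ + 1 := by linarith
  obtain rfl : t₂ = r₂ + b₂ * q₂ + 1 := by linarith
  have e : b₂ * (r₁ + b₁ * q₁ + 1) - b₁ * (r₂ + b₂ * q₂ + 1) +
      (b₁ - b₂ - b₂ * r₁ + b₁ * r₂ - b₁ * b₂ * δ + 1) = b₁ * b₂ * (q₁ - q₂ - δ) + 1 := by ring
  rw [e]
  constructor
  · intro h'
    have : 0 ≤ b₁ * b₂ * (q₁ - q₂ - δ) := mul_nonneg h.le (by linarith)
    linarith
  · intro h'
    have : 0 ≤ q₁ - q₂ - δ := by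
      by_contra hc
      have : q₁ - q₂ - δ ≤ -1 := by linarith [Int.add_one_le_of_lt (not_le.1 hc)]
      nlinarith
    linarith

/-- Coefficients and constants `(b, α, c)` of the forms that bound the quantified variable. -/
noncomputable def thresholdForms (W : Finset ℕ) (A B : ℕ) : Finset (ℤ × (ℕ →₀ ℤ) × ℤ) :=
  Finset.Icc 1 (A : ℤ) ×ˢ (W.finsupp fun _ => Finset.Icc (-A : ℤ) A) ×ˢ
    Finset.Icc (-(B + 1) : ℤ) (B + 1)

theorem mem_thresholdForms {W : Finset ℕ} {A B : ℕ} {θ : ℤ × (ℕ →₀ ℤ) × ℤ} :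
    θ ∈ thresholdForms W A B ↔ (1 ≤ θ.1 ∧ θ.1 ≤ A) ∧
      (θ.2.1.support ⊆ W ∧ ∀ i ∈ W, |θ.2.1 i| ≤ A) ∧ |θ.2.2| ≤ B + 1 := by
  simp [thresholdForms, Finset.mem_finsupp_iff, abs_le]

/-- The thresholds at an assignment. -/
noncomputable def thresholds (W : Finset ℕ) (A B : ℕ) (f : ℕ → ℤ) (θ : thresholdForms W A B) : ℤ :=
  threshold θ.1.1 (linForm W θ.1.2.1 θ.1.2.2 f)

/-- Cutting `α` off outside `W` makes it finitely supported, so that a finite index set of forms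
suffices. -/
theorem exists_thresholdForm {W : Finset ℕ} {A B : ℕ} {b c : ℤ} {α : ℕ → ℤ} (hb : 1 ≤ b)
    (hbA : b ≤ A) (hα : ∀ i ∈ W, |α i| ≤ A) (hc : |c| ≤ B + 1) :
    ∃ θ : thresholdForms W A B, ∀ f, thresholds W A B f θ = threshold b (linForm W α c f) := by
  classical
  have hs : ∀ i, (if i ∈ W then α i else 0) ≠ 0 → i ∈ W := fun i hi => by
    by_contra h
    exact hi (if_neg h)
  refine ⟨⟨(b, Finsupp.onFinset W _ hs, c),
    mem_thresholdForms.2 ⟨⟨hb, hbA⟩, ⟨Finsupp.support_onFinset_subset (hf := hs), fun i hi => ?_⟩, hc⟩⟩,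
    fun f => ?_⟩
  · simpa [hi] using hα i hi
  · have : ∑ i ∈ W, (if i ∈ W then α i else 0) * f i = ∑ i ∈ W, α i * f i :=
      Finset.sum_congr rfl fun i hi => by rw [if_pos hi]
    simp only [thresholds, linForm, Finsupp.onFinset_apply, this]

/-- Assignments of the same position relative to the thresholds are similar. -/
theorem similar_update {W : Finset ℕ} {y : ℕ} (hy : y ∉ W) {A B M A' B' M' : ℕ} {f g : ℕ → ℤ}
    (h : Similar W A' B' M' f g) (hA : A ≤ A') (hB : B ≤ B') (hM : M ∣ M') {a a' : ℤ}
    (ha : position (thresholds W A B f) M a = position (thresholds W A B g) M a') :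
    Similar (insert y W) A B M (Function.update f y a) (Function.update g y a') := by
  have h0 : Similar W A B M f g := h.mono subset_rfl hA hB hM
  simp only [position, Prod.mk.injEq, Set.ext_iff, Set.mem_ofPred_eq,
    ZMod.intCast_eq_intCast_iff] at ha
  refine ⟨fun i hi => ?_, fun α c hα hc => ?_⟩
  · rcases eq_or_ne i y with rfl | hiy
    · simpa using ha.2
    · simpa [hiy] using h0.modEq i (Finset.mem_of_mem_insert_of_ne hi hiy)
  · rw [linForm_update hy, linForm_update hy]
    have hαy := abs_le.1 (hα y (Finset.mem_insert_self _ _))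
    have hαW : ∀ i ∈ W, |α i| ≤ A := fun i hi => hα i (Finset.mem_insert_of_mem hi)
    rcases lt_trichotomy (α y) 0 with hneg | hzero | hpos
    -- A negative coefficient gives an upper bound, the negation of a threshold condition for `1 -
    -- t`; hence constants up to `B + 1`.
    · have e : ∀ f, 1 - linForm W α c f = linForm W (fun i => -α i) (1 - c) f := by
        intro f; simp [linForm]; ring
      obtain ⟨θ, hθ⟩ := exists_thresholdForm (W := W) (A := A) (B := B) (b := -α y)
        (c := 1 - c) (α := fun i => -α i) (by omega) (by omega) (by simpa using hαW)
        (by rw [abs_le] at hc ⊢; omega)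
      have := ha.1 θ
      rw [hθ, hθ, ← e, ← e] at this
      have k := fun t a => neg_iff_threshold_le (b := -α y) (by omega) t a
      simp only [neg_neg] at k
      rw [k, k, this]
    · simpa [hzero] using h0.pos α c hαW hc
    · obtain ⟨θ, hθ⟩ := exists_thresholdForm (W := W) (A := A) (B := B) (b := α y)
        (c := c) (α := α) (by omega) (by omega) hαW (by omega)
      have := ha.1 θ
      rw [hθ, hθ] at this
      rw [← threshold_le_iff hpos, ← threshold_le_iff hpos, this]

/-! ### Eliminating one quantifier -/

-- The modulus is divisible by `b * p * M` for all `1 ≤ b ≤ A`. Comparing two thresholds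
-- cross-multiplies their forms, which gives coefficients up to `2 * A ^ 2`; the constant also
-- absorbs the remainders and a gap `δ ≤ M`.
open Nat in
theorem countEq_of_similar {W : Finset ℕ} {y : ℕ} (hy : y ∉ W) {A B M p P : ℕ} (hA : 2 ≤ A)
    (hB : 2 ≤ B) (hM : 0 < M) (hp : 0 < p) (hpP : p ≤ P) {R : (ℕ → ℤ) → Prop}
    (hR : Determined (insert y W) A B M R) {f g : ℕ → ℤ}
    (h : Similar W (2 * A ^ 2) (4 * A ^ 2 * M * B) (M * A ! * P !) f g) :
    CountEq p {a | R (Function.update f y a)} {a | R (Function.update g y a)} := by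
  have hdvd : ∀ b : ℤ, 1 ≤ b → b ≤ A → b * (p * M : ℕ) ∣ (M * A ! * P ! : ℕ) := by
    intro b hb hbA
    lift b to ℕ using by omega
    have h1 : b ∣ A ! := Nat.dvd_factorial (by omega) (by omega)
    have h2 : p ∣ P ! := Nat.dvd_factorial hp hpP
    have := mul_dvd_mul h1 (mul_dvd_mul h2 (dvd_refl M))
    rw [← mul_assoc, mul_comm _ M, ← mul_assoc] at this
    exact_mod_cast (by simpa [mul_assoc, mul_comm, mul_left_comm] using this : b * (p * M) ∣ M * A ! * P !)
  have hAM : A ≤ 2 * A ^ 2 := by nlinarith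
  have hBM : B ≤ 4 * A ^ 2 * M * B := Nat.le_mul_of_pos_left _ (by positivity)
  have hMM : M ∣ M * A ! * P ! := ⟨A ! * P !, by ring⟩
  have : NeZero M := ⟨hM.ne'⟩
  refine CountEq.of_classes (τ := position (thresholds W A B f) M)
    (τ' := position (thresholds W A B g) M) ?_ ?_
  · refine countEq_position hM ?_ ?_
    · rintro ⟨⟨b, α, c⟩, hθ⟩
      obtain ⟨⟨hb, hbA⟩, -⟩ := mem_thresholdForms.1 hθ
      exact threshold_modEq (Int.lt_of_add_one_le hb) ((h.linForm_modEq _ _).of_dvd (hdvd b hb hbA))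
    · rintro ⟨⟨b₁, α₁, c₁⟩, hθ₁⟩ ⟨⟨b₂, α₂, c₂⟩, hθ₂⟩ δ hδ hδM
      obtain ⟨⟨hb₁, hbA₁⟩, ⟨-, hα₁⟩, hc₁⟩ := mem_thresholdForms.1 hθ₁
      obtain ⟨⟨hb₂, hbA₂⟩, ⟨-, hα₂⟩, hc₂⟩ := mem_thresholdForms.1 hθ₂
      simp only [thresholds] at *
      have hb₁' : 0 < b₁ := hb₁
      have hb₂' : 0 < b₂ := hb₂
      rw [threshold_add_le_iff hb₁' hb₂', threshold_add_le_iff hb₁' hb₂']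
      -- Equal remainders make the correction constant the same for `f` and `g`.
      have res : ∀ b : ℤ, 1 ≤ b → b ≤ A → ∀ (α : ℕ → ℤ) (c : ℤ),
          (linForm W α c f - 1) % b = (linForm W α c g - 1) % b := fun b hb hbA α c =>
        ((h.linForm_modEq α c).of_dvd ((Dvd.intro _ rfl).trans (hdvd b hb hbA))).sub_right 1
      rw [← res b₁ hb₁ hbA₁, ← res b₂ hb₂ hbA₂]
      have r₁ := Int.emod_nonneg (linForm W α₁ c₁ f - 1) hb₁'.ne'
      have r₁' := Int.emod_lt_of_pos (linForm W α₁ c₁ f - 1) hb₁'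
      have r₂ := Int.emod_nonneg (linForm W α₂ c₂ f - 1) hb₂'.ne'
      have r₂' := Int.emod_lt_of_pos (linForm W α₂ c₂ f - 1) hb₂'
      generalize (linForm W α₁ c₁ f - 1) % b₁ = s₁ at *
      generalize (linForm W α₂ c₂ f - 1) % b₂ = s₂ at *
      have e : ∀ f (k : ℤ), b₂ * linForm W α₁ c₁ f - b₁ * linForm W α₂ c₂ f + k =
          linForm W (fun i => b₂ * α₁ i - b₁ * α₂ i) (b₂ * c₁ - b₁ * c₂ + k) f := by
        intro f k
        simp only [linForm, sub_mul, Finset.sum_sub_distrib, mul_add, Finset.mul_sum, mul_assoc]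
        ring
      rw [e, e]
      have hA' : (2 : ℤ) ≤ A := by exact_mod_cast hA
      have hB' : (2 : ℤ) ≤ B := by exact_mod_cast hB
      have hM' : (1 : ℤ) ≤ M := by exact_mod_cast hM
      have bd : ∀ {b u : ℤ} {U : ℤ}, 1 ≤ b → b ≤ A → |u| ≤ U → |b * u| ≤ A * U := by
        intro b u U hb hbA hu
        rw [abs_mul, abs_of_nonneg (by omega : 0 ≤ b)]
        exact mul_le_mul hbA hu (abs_nonneg _) (by omega)
      refine h.pos _ _ (fun i hi => ?_) ?_
      · have h1 := bd hb₂ hbA₂ (hα₁ i hi)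
        have h2 := bd hb₁ hbA₁ (hα₂ i hi)
        push_cast
        rw [abs_le] at h1 h2 ⊢
        constructor <;> nlinarith
      · have h1 := abs_le.1 (bd hb₂ hbA₂ hc₁)
        have h2 := abs_le.1 (bd hb₁ hbA₁ hc₂)
        have h3 := abs_le.1 (bd hb₂ hbA₂ (abs_le.2 ⟨by omega, by omega⟩ : |s₁| ≤ A))
        have h4 := abs_le.1 (bd hb₁ hbA₁ (abs_le.2 ⟨by omega, by omega⟩ : |s₂| ≤ A))
        have h3' : 0 ≤ b₂ * s₁ := mul_nonneg hb₂'.le r₁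
        have h4' : 0 ≤ b₁ * s₂ := mul_nonneg hb₁'.le r₂
        have h5 := abs_le.1 (bd hb₁ hbA₁
          (bd hb₂ hbA₂ (abs_le.2 ⟨by omega, hδM⟩ : |δ| ≤ M)))
        have h5' : 0 ≤ b₁ * (b₂ * δ) := mul_nonneg hb₁'.le (mul_nonneg hb₂'.le hδ)
        have q1 : (2 : ℤ) * A ≤ A * A := by nlinarith
        have q2 : (A : ℤ) * A * 2 ≤ A * A * B := by gcongr
        have q3 : (A : ℤ) * A * B * 1 ≤ A * A * B * M := by gcongr
        have q4 : (A : ℤ) * A * M * 2 ≤ A * A * M * B := by gcongr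
        have q5 : (2 : ℤ) * A * B ≤ A * A * B := by gcongr
        push_cast
        rw [abs_le]
        constructor <;> nlinarith
  · intro a a' haa
    exact hR _ _ (similar_update hy h hAM hBM hMM haa)


/-! ### Induction on formulas -/

namespace Term

theorem coeff_eq_zero {t : Term} {j : ℕ} (h : j ∉ t.vars) : t.coeff j = 0 := by
  induction t with
  | var i => simp only [vars, Finset.mem_singleton] at h; simp [coeff, Ne.symm h]
  | const c => rfl
  | smul a t ih => rw [coeff, ih h, mul_zero]
  | add s t ihs iht =>
    simp only [vars, Finset.mem_union, not_or] at h
    rw [coeff, ihs h.1, iht h.2, add_zero]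

theorem eval_eq_linForm {t : Term} {W : Finset ℕ} (h : t.vars ⊆ W) (f : ℕ → ℤ) :
    t.eval f = linForm W (fun j => t.coeff j) t.constPart f := by
  induction t with
  | var i =>
    have : i ∈ W := h (Finset.mem_singleton_self i)
    simp [eval, linForm, coeff, constPart, this]
  | const c => simp [eval, linForm, coeff, constPart]
  | smul a t ih =>
    simp only [eval, ih h, linForm, coeff, constPart, mul_add, Finset.mul_sum, mul_assoc]
  | add s t ihs iht =>
    rw [eval, ihs (Finset.union_subset_left h), iht (Finset.union_subset_right h)]
    simp only [linForm, coeff, constPart, add_mul, Finset.sum_add_distrib]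
    ring

theorem eval_sub (s t : Term) (f : ℕ → ℤ) : (s.sub t).eval f = s.eval f - t.eval f := by
  simp only [sub, eval]; ring

end Term

/-- Coefficient bound after eliminating `r` quantifiers. -/
def coeffBound (P : ℕ) : ℕ → ℕ
  | 0 => P
  | r + 1 => 2 * coeffBound P r ^ 2

open Nat in
/-- Modulus after eliminating `r` quantifiers. -/
def modulus (P : ℕ) : ℕ → ℕ
  | 0 => P !
  | r + 1 => modulus P r * (coeffBound P r)! * P !

/-- Bound on the constants after eliminating `r` quantifiers. -/
def constBound (P c : ℕ) : ℕ → ℕ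
  | 0 => c
  | r + 1 => 4 * coeffBound P r ^ 2 * modulus P r * constBound P c r

theorem modulus_pos (P r : ℕ) : 0 < modulus P r := by
  induction r with
  | zero => exact Nat.factorial_pos P
  | succ r ih => exact Nat.mul_pos (Nat.mul_pos ih (Nat.factorial_pos _)) (Nat.factorial_pos _)

theorem le_coeffBound (P r : ℕ) : P ≤ coeffBound P r := by
  induction r with
  | zero => rfl
  | succ r ih => rw [coeffBound]; nlinarith

theorem le_constBound {P : ℕ} (hP : 2 ≤ P) (c r : ℕ) : c ≤ constBound P c r := by
  induction r with
  | zero => rfl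
  | succ r ih =>
    have := modulus_pos P r
    have := hP.trans (le_coeffBound P r)
    exact ih.trans (Nat.le_mul_of_pos_left _ (by positivity))

open Nat in
theorem factorial_dvd_modulus (P r : ℕ) : P ! ∣ modulus P r := by
  cases r with
  | zero => rfl
  | succ r => exact Dvd.intro_left _ rfl

theorem determined_sat {P c : ℕ} (hP : 2 ≤ P) (hc : 2 ≤ c) (φ : Formula) :
    ∀ (d : ℕ) (W : Finset ℕ), φ.qd ≤ d → φ.freeVars ⊆ W → (∀ a ∈ φ.coeffs, a ≤ (P : ℤ)) →
      (∀ k ∈ φ.moduli, k ≤ P) → (∀ a ∈ φ.consts, a ≤ (c : ℤ)) →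
      Determined W (coeffBound P d) (constBound P c d) (modulus P d) φ.Sat := by
  induction φ with
  | lt s t =>
    intro d W _ hW hco _ hcon f g h
    have key : ∀ f : ℕ → ℤ, s.eval f < t.eval f ↔
        0 < linForm W (fun j => -(s.sub t).coeff j) (-(s.sub t).constPart) f := by
      intro f
      have h1 := Term.eval_eq_linForm (t := s.sub t) hW f
      have h2 : linForm W (fun j => -(s.sub t).coeff j) (-(s.sub t).constPart) f =
          -linForm W (fun j => (s.sub t).coeff j) (s.sub t).constPart f := by
        simp [linForm]; ring
      rw [h2, ← h1, Term.eval_sub]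
      constructor <;> intro h <;> linarith
    rw [Formula.Sat, Formula.Sat, key, key]
    refine h.pos _ _ (fun i _ => ?_) ?_
    · refine le_trans ?_ (Int.ofNat_le.2 (le_coeffBound P d))
      rw [abs_neg]
      by_cases hi : i ∈ (s.sub t).vars
      · refine abs_le'.2 ⟨hco _ ?_, hco _ ?_⟩
        · exact Finset.mem_union_left _ (Finset.mem_union_right _ (Finset.mem_image_of_mem _ hi))
        · exact Finset.mem_union_right _ (Finset.mem_image_of_mem (fun j => -(s.sub t).coeff j) hi)
      · simp [Term.coeff_eq_zero hi]
    · refine le_trans ?_ (Int.ofNat_le.2 (le_constBound hP c d))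
      rw [abs_neg]
      exact abs_le'.2 ⟨hcon _ (by simp [Formula.consts]), hcon _ (by simp [Formula.consts])⟩
  | cong k hk s t =>
    intro d W _ hW _ hmod _ f g h
    have hkM : k ∣ modulus P d :=
      (Nat.dvd_factorial hk (hmod k (by simp [Formula.moduli]))).trans (factorial_dvd_modulus P d)
    have := (h.linForm_modEq (fun j => (s.sub t).coeff j) (s.sub t).constPart).of_dvd
      (Int.natCast_dvd_natCast.2 hkM)
    rw [← Term.eval_eq_linForm hW, ← Term.eval_eq_linForm hW, Term.eval_sub,
      Term.eval_sub] at this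
    rw [Formula.Sat, Formula.Sat, Int.dvd_iff_emod_eq_zero, Int.dvd_iff_emod_eq_zero, this]
  | neg φ ih =>
    intro d W hd hW h1 h2 h3 f g h
    exact not_congr (ih d W hd hW h1 h2 h3 f g h)
  | conj φ ψ ihφ ihψ | disj φ ψ ihφ ihψ | imp φ ψ ihφ ihψ | equiv φ ψ ihφ ihψ =>
    intro d W hd hW h1 h2 h3 f g h
    simp only [Formula.coeffs, Formula.moduli, Formula.consts, Finset.forall_mem_union] at h1 h2 h3
    have e₁ := ihφ d W ((le_max_left _ _).trans hd) (Finset.union_subset_left hW) h1.1 h2.1 h3.1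
      f g h
    have e₂ := ihψ d W ((le_max_right _ _).trans hd) (Finset.union_subset_right hW) h1.2 h2.2 h3.2
      f g h
    simp only [Formula.Sat, e₁, e₂]
  | ex y φ ih =>
    intro d W hd hW h1 h2 h3 f g h
    obtain ⟨d, rfl⟩ : ∃ e, d = e + 1 := ⟨d - 1, by simp only [Formula.qd] at hd; omega⟩
    -- `W` may contain the bound variable `y`, whose old value is irrelevant.
    have ih' := ih d (insert y (W.erase y)) (by simp only [Formula.qd] at hd; omega)
      (fun v hv => by
        by_cases hvy : v = y
        · simp [hvy]
        · simpa [hvy] using hW (Finset.mem_erase.2 ⟨hvy, hv⟩)) h1 h2 h3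
    -- Only nonemptiness matters here, so `p = 1` will do.
    exact (countEq_of_similar (Finset.notMem_erase y W) (hP.trans (le_coeffBound P d))
      (hc.trans (le_constBound hP c d)) (modulus_pos P d) one_pos (by omega) ih'
      (h.mono (Finset.erase_subset y W) le_rfl le_rfl dvd_rfl)).nonempty
  | exMod q p hp y φ ih =>
    intro d W hd hW h1 h2 h3 f g h
    obtain ⟨d, rfl⟩ : ∃ e, d = e + 1 := ⟨d - 1, by simp only [Formula.qd] at hd; omega⟩
    simp only [Formula.moduli, Finset.forall_mem_insert] at h2
    have ih' := ih d (insert y (W.erase y)) (by simp only [Formula.qd] at hd; omega)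
      (fun v hv => by
        by_cases hvy : v = y
        · simp [hvy]
        · simpa [hvy] using hW (Finset.mem_erase.2 ⟨hvy, hv⟩)) h1 h2.2 h3
    have key := countEq_of_similar (p := p) (P := P) (Finset.notMem_erase y W)
      (hP.trans (le_coeffBound P d))
      (hc.trans (le_constBound hP c d)) (modulus_pos P d) (by omega) h2.1 ih'
      (h.mono (Finset.erase_subset y W) le_rfl le_rfl dvd_rfl)
    exact and_congr key.finite ⟨key.ncard.symm.trans, key.ncard.trans⟩

/-! ### Size estimates -/

/-- The extra factor `P ≥ 2` absorbs the 2 of the recursion, leaving pure squaring. -/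
theorem coeffBound_le {P : ℕ} (hP : 2 ≤ P) (r : ℕ) : P * coeffBound P r ≤ P ^ 2 ^ (r + 1) := by
  induction r with
  | zero => simp [coeffBound, sq]
  | succ r ih =>
    calc P * (2 * coeffBound P r ^ 2) ≤ P * (P * coeffBound P r ^ 2) := by gcongr
      _ = (P * coeffBound P r) ^ 2 := by ring
      _ ≤ (P ^ 2 ^ (r + 1)) ^ 2 := by gcongr
      _ = P ^ 2 ^ (r + 1 + 1) := by rw [← pow_mul, ← pow_succ]

open Nat in
theorem factorial_le_two_pow_sq (n : ℕ) : n ! ≤ 2 ^ n ^ 2 :=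
  calc n ! ≤ n ^ n := Nat.factorial_le_pow n
    _ ≤ (2 ^ n) ^ n := by gcongr; exact Nat.lt_two_pow_self.le
    _ = 2 ^ n ^ 2 := by rw [← pow_mul, sq]

/-- By `n ! ≤ 2 ^ n ^ 2`, the two new factorials together cost at most `2 * coeffBound P r ^ 2` in
the exponent, which is `coeffBound P (r + 1)`. -/
theorem modulus_le {P : ℕ} (hP : 2 ≤ P) (r : ℕ) : modulus P r ≤ 2 ^ coeffBound P (r + 1) := by
  induction r with
  | zero =>
    refine (factorial_le_two_pow_sq P).trans (Nat.pow_le_pow_right two_pos ?_)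
    simp only [coeffBound]; omega
  | succ r ih =>
    have hA := le_coeffBound P r
    calc modulus P (r + 1)
        ≤ 2 ^ coeffBound P (r + 1) * 2 ^ coeffBound P r ^ 2 * 2 ^ coeffBound P r ^ 2 :=
          Nat.mul_le_mul (Nat.mul_le_mul ih (factorial_le_two_pow_sq _))
            ((factorial_le_two_pow_sq P).trans (Nat.pow_le_pow_right two_pos (by gcongr)))
      _ = 2 ^ (2 * coeffBound P (r + 1)) := by
          rw [← pow_add, ← pow_add]; congr 1; rw [coeffBound]; ring
      _ ≤ 2 ^ coeffBound P (r + 2) := by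
          refine Nat.pow_le_pow_right two_pos ?_
          have := hP.trans (le_coeffBound P (r + 1))
          rw [coeffBound.eq_2 P (r + 1)]; nlinarith

theorem constBound_le {P : ℕ} (hP : 2 ≤ P) (c r : ℕ) :
    constBound P c r ≤ 2 ^ coeffBound P (r + 1) * c := by
  induction r with
  | zero => exact Nat.le_mul_of_pos_left _ (by positivity)
  | succ r ih =>
    calc constBound P c (r + 1)
        = 2 * coeffBound P (r + 1) * modulus P r * constBound P c r := by
          simp only [constBound, coeffBound]; ring
      _ ≤ 2 ^ coeffBound P (r + 1) * 2 ^ coeffBound P (r + 1) *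
          (2 ^ coeffBound P (r + 1) * c) := by
          gcongr
          · have h := Nat.lt_two_pow_self (n := coeffBound P (r + 1) - 1)
            have h2 := hP.trans (le_coeffBound P (r + 1))
            have : 2 ^ coeffBound P (r + 1) = 2 * 2 ^ (coeffBound P (r + 1) - 1) := by
              rw [← pow_succ']; congr 1; omega
            omega
          · exact modulus_le hP r
      _ = 2 ^ (3 * coeffBound P (r + 1)) * c := by ring
      _ ≤ 2 ^ coeffBound P (r + 2) * c := by
          gcongr
          · norm_num
          · have := hP.trans (le_coeffBound P (r + 1))
            rw [coeffBound.eq_2 P (r + 1)]; nlinarith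

/-- With `E = 2 ^ coeffBound P (d + 1)`, each summand is at most `E * c * N * max 1 l`. Rounding 3
up to 4 adds 2 to the exponent. -/
theorem period_le_bound {P d : ℕ} (hP : 2 ≤ P) (hd : 1 ≤ d) {c N : ℕ} (hc : 2 ≤ c) (hN : 1 ≤ N)
    (l : ℕ) :
    coeffBound P d * l * N + constBound P c d + modulus P d ≤
      2 ^ P ^ 16 ^ d * c * N * max 1 l := by
  have hA : coeffBound P d ≤ 2 ^ coeffBound P (d + 1) := by
    refine Nat.lt_two_pow_self.le.trans (Nat.pow_le_pow_right two_pos ?_)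
    rw [coeffBound]; nlinarith
  have hE : coeffBound P (d + 1) + 2 ≤ P ^ 16 ^ d := by
    calc coeffBound P (d + 1) + 2 ≤ P * coeffBound P (d + 1) := by
          have := hP.trans (le_coeffBound P (d + 1)); nlinarith
      _ ≤ P ^ 2 ^ (d + 2) := coeffBound_le hP (d + 1)
      _ ≤ P ^ 16 ^ d := by
          refine Nat.pow_le_pow_right (by omega) ?_
          -- The choice of 16 reduces the claim to `d + 2 ≤ 4 * d`, which holds as `d ≥ 1`.
          rw [show 16 = 2 ^ 4 by norm_num, ← pow_mul]
          exact Nat.pow_le_pow_right two_pos (by omega)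
  have h1 : (1 : ℕ) ≤ max 1 l := le_max_left _ _
  have h2 : l ≤ max 1 l := le_max_right _ _
  generalize hE' : 2 ^ coeffBound P (d + 1) = E at *
  calc coeffBound P d * l * N + constBound P c d + modulus P d
      ≤ E * max 1 l * N + E * c + E := by
        gcongr
        · exact hE' ▸ constBound_le hP c d
        · exact hE' ▸ modulus_le hP d
    _ ≤ E * c * N * max 1 l + E * c * N * max 1 l + E * c * N * max 1 l := by
        have a1 : E * max 1 l * N ≤ E * c * N * max 1 l := by
          calc E * max 1 l * N = E * 1 * N * max 1 l := by ring
            _ ≤ _ := by gcongr; omega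
        have a2 : E * c ≤ E * c * N * max 1 l := by
          calc E * c = E * c * 1 * 1 := by ring
            _ ≤ _ := by gcongr
        have a3 : E ≤ E * c := Nat.le_mul_of_pos_right _ (by omega)
        omega
    _ ≤ (E * 4) * c * N * max 1 l := by
        have : E * 4 * c * N * max 1 l = 4 * (E * c * N * max 1 l) := by ring
        omega
    _ = 2 ^ (coeffBound P (d + 1) + 2) * c * N * max 1 l := by rw [← hE', pow_add]; norm_num
    _ ≤ _ := by gcongr; norm_num

/-! ### Eventually periodic sets -/

/-- A set of integers with period `D` on `(T, ∞)` and on `(-∞, -T)`. -/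
def EventuallyPeriodic (T D : ℕ) (S : Set ℤ) : Prop :=
  ∀ m m' : ℤ, m ≡ m' [ZMOD D] → (T < m ∧ T < m' ∨ m < -T ∧ m' < -T) → (m ∈ S ↔ m' ∈ S)

namespace EventuallyPeriodic

variable {T D : ℕ} {S : Set ℤ}

/-- The residue class of `m` meets the window of length `D` just beyond `C` on the same side of 0.
-/
theorem exists_mem (hS : EventuallyPeriodic T D S) (hD : 0 < D) {m : ℤ} (hm : m ∈ S)
    (hTm : (T : ℤ) < |m|) {C : ℕ} (hC : T ≤ C) : ∃ m' ∈ S, (C : ℤ) < |m'| ∧ |m'| ≤ C + D := by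
  have hD' : (0 : ℤ) < D := by exact_mod_cast hD
  have r0 := fun n : ℤ => Int.emod_nonneg n hD'.ne'
  have r1 := fun n : ℤ => Int.emod_lt_of_pos n hD'
  have hcong : ∀ n : ℤ, C + 1 + (n - (C + 1)) % D ≡ n [ZMOD D] := fun n => by
    simpa using (Int.mod_modEq (n - (C + 1)) D).add_left (C + 1)
  rcases lt_abs.1 hTm with h | h
  · have := r0 (m - (C + 1)); have := r1 (m - (C + 1))
    refine ⟨C + 1 + (m - (C + 1)) % D, (hS _ _ (hcong m) (.inl ⟨by omega, h⟩)).2 hm, ?_⟩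
    rw [abs_of_nonneg (by omega)]
    omega
  · have := r0 (-m - (C + 1)); have := r1 (-m - (C + 1))
    refine ⟨-(C + 1 + (-m - (C + 1)) % D),
      (hS _ m (by simpa using (hcong (-m)).neg) (.inr ⟨by omega, by omega⟩)).2 hm, ?_⟩
    rw [abs_neg, abs_of_nonneg (by omega)]
    omega

theorem nonempty_iff (hS : EventuallyPeriodic T D S) (hD : 0 < D) {C : ℕ} (hC : T + D ≤ C) :
    S.Nonempty ↔ ∃ m : ℤ, |m| ≤ C ∧ m ∈ S := by
  refine ⟨fun ⟨m, hm⟩ => ?_, fun ⟨m, _, hm⟩ => ⟨m, hm⟩⟩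
  by_cases hTm : (T : ℤ) < |m|
  · obtain ⟨m', hm', _, h⟩ := hS.exists_mem hD hm hTm le_rfl
    exact ⟨m', by omega, hm'⟩
  · exact ⟨m, by omega, hm⟩

theorem not_finite (hS : EventuallyPeriodic T D S) (hD : 0 < D) {m : ℤ} (hm : m ∈ S)
    (hTm : (T : ℤ) < |m|) : ¬ S.Finite := by
  intro hfin
  obtain ⟨b, hb⟩ := (hfin.image fun m : ℤ => |m|).bddAbove
  obtain ⟨m', hm', h, _⟩ := hS.exists_mem hD hm hTm (C := max T b.toNat) (le_max_left _ _)
  have : |m'| ≤ b := hb ⟨m', hm', rfl⟩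
  have : b.toNat ≤ max T b.toNat := le_max_right _ _
  omega

theorem finite_and_iff (hS : EventuallyPeriodic T D S) (hD : 0 < D) {C : ℕ} (hC : T + D ≤ C)
    (hC2 : 2 ≤ C) (Q : ℕ → Prop) :
    S.Finite ∧ Q S.ncard ↔
      (¬ ∃ m : ℤ, C < |m| ∧ |m| ≤ (C : ℤ) ^ 2 ∧ m ∈ S) ∧ Q {m : ℤ | |m| ≤ C ∧ m ∈ S}.ncard := by
  have hsub : (∀ m ∈ S, ¬ (C : ℤ) < |m|) → {m : ℤ | |m| ≤ C ∧ m ∈ S} = S := fun h =>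
    Set.ext fun m => ⟨fun hm => hm.2, fun hm => ⟨not_lt.1 (h m hm), hm⟩⟩
  constructor
  · rintro ⟨hfin, hQ⟩
    have h : ∀ m ∈ S, ¬ (C : ℤ) < |m| := fun m hm hCm =>
      hS.not_finite hD hm (by omega) hfin
    exact ⟨fun ⟨m, hCm, _, hm⟩ => h m hm hCm, by rwa [hsub h]⟩
  · rintro ⟨hno, hQ⟩
    have h : ∀ m ∈ S, ¬ (C : ℤ) < |m| := fun m hm hCm => by
      obtain ⟨m', hm', h1, h2⟩ := hS.exists_mem hD hm (by omega) (C := C) (by omega)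
      refine hno ⟨m', h1, h2.trans ?_, hm'⟩
      -- The window fits because `C + D ≤ 2 * C ≤ C ^ 2`.
      have : (D : ℤ) ≤ C := by omega
      have : (2 : ℤ) ≤ C := by omega
      nlinarith
    refine ⟨(Set.finite_Icc (-C : ℤ) C).subset fun m hm => ?_, by rwa [hsub h] at hQ⟩
    exact abs_le.1 (not_lt.1 (h m hm))

end EventuallyPeriodic

/-- Beyond the stated bound, `x` outweighs the rest of any form in which its coefficient is nonzero,
so the sign depends only on that coefficient and the side of 0. -/
theorem Determined.eventuallyPeriodic {V : Finset ℕ} {x : ℕ} (hx : x ∉ V) {A B M : ℕ}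
    {R : (ℕ → ℤ) → Prop} (hR : Determined (insert x V) A B M R) {f : ℕ → ℤ} {N l : ℕ}
    (hf : ∀ i ∈ V, |f i| ≤ N) (hV : V.card ≤ l) :
    EventuallyPeriodic (A * l * N + B) M {m | R (Function.update f x m)} := by
  intro m m' hmm hT
  refine hR _ _ ⟨fun i hi => ?_, fun α c hα hc => ?_⟩
  · rcases eq_or_ne i x with rfl | hix
    · simpa using hmm
    · simp [hix]
  · rw [linForm_update hx, linForm_update hx]
    have hb : |linForm V α c f| ≤ (A * l * N + B : ℕ) := by
      have h1 : |∑ i ∈ V, α i * f i| ≤ V.card * (A * N : ℤ) := by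
        refine (Finset.abs_sum_le_sum_abs _ _).trans ?_
        rw [← nsmul_eq_mul]
        refine Finset.sum_le_card_nsmul _ _ _ fun i hi => ?_
        rw [abs_mul]
        exact mul_le_mul (hα i (Finset.mem_insert_of_mem hi)) (hf i hi) (abs_nonneg _)
          (by positivity)
      have h2 : (V.card : ℤ) * (A * N : ℤ) ≤ l * (A * N) := by gcongr
      refine (abs_add_le _ _).trans ?_
      push_cast
      linarith
    generalize linForm V α c f = t at *
    generalize A * l * N + B = T at *
    rw [abs_le] at hb
    rcases lt_trichotomy (α x) 0 with h | h | h
    · have h' : α x ≤ -1 := by omega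
      rcases hT with ⟨h1, h2⟩ | ⟨h1, h2⟩
      · exact iff_of_false (by nlinarith) (by nlinarith)
      · exact iff_of_true (by nlinarith) (by nlinarith)
    · simp [h]
    · have h' : 1 ≤ α x := by omega
      rcases hT with ⟨h1, h2⟩ | ⟨h1, h2⟩
      · exact iff_of_true (by nlinarith) (by nlinarith)
      · exact iff_of_false (by nlinarith) (by nlinarith)

/-! ### Conclusion -/

namespace Formula

theorem two_mem_coeffs (φ : Formula) : (2 : ℤ) ∈ φ.coeffs := by
  induction φ <;> simp_all [coeffs]

theorem two_mem_consts (φ : Formula) : (2 : ℤ) ∈ φ.consts := by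
  induction φ <;> simp_all [consts]

theorem two_le_maxParam (φ : Formula) : 2 ≤ φ.maxParam := by
  exact_mod_cast φ.isGreatest_maxParam.2 (Finset.mem_union_left _ φ.two_mem_coeffs)

theorem two_le_maxConst (φ : Formula) : 2 ≤ φ.maxConst := by
  exact_mod_cast φ.isGreatest_maxConst.2 φ.two_mem_consts

theorem bound_mono {φ : Formula} {κ e e' : ℕ} (hκ : 1 ≤ κ) (he : e ≤ e') (N l : ℕ) :
    φ.bound κ e N l ≤ φ.bound κ e' N l := by
  have := φ.two_le_maxParam
  unfold bound
  gcongr <;> omega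

end Formula

end ModCount

theorem corollaryC2 :
    ∃ κ : ℕ, 2 ≤ κ ∧
      ∀ (d : ℕ) (_ : 1 ≤ d)
        (φ : ModCount.Formula) (_ : φ.qd ≤ d)
        (l x : ℕ) (y : Fin l → ℕ) (_ : Function.Injective y) (_ : ∀ i, y i ≠ x)
        (_ : ∀ v ∈ φ.freeVars, v = x ∨ ∃ i, v = y i)
        (N : ℕ) (_ : 1 ≤ N)
        (n : Fin l → ℤ) (_ : ∀ i, |n i| ≤ (N : ℤ))
        (f : ℕ → ℤ) (_ : ∀ i, f (y i) = n i),
        -- `κ` is a constant bounding the least witnesses of existential quantifiers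
        ((ModCount.Formula.ex x φ).Sat f ↔
          ∃ m : ℤ, |m| ≤ (φ.bound κ d N l : ℤ) ∧ φ.Sat (Function.update f x m)) ∧
        -- and, with the same `κ`, modulo counting reduces to bounded witnesses
        ∀ (q p : ℕ) (hp : 2 ≤ p) (C : ℕ) (_ : C = φ.bound κ (d + 1) N l),
          ((ModCount.Formula.exMod q p hp x φ).Sat f ↔
            (¬ ∃ m : ℤ, (C : ℤ) < |m| ∧ |m| ≤ (C : ℤ) ^ 2 ∧ φ.Sat (Function.update f x m)) ∧
            {m : ℤ | |m| ≤ (C : ℤ) ∧ φ.Sat (Function.update f x m)}.ncard ≡ q [MOD p]) := by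
  refine ⟨16, by norm_num, ?_⟩
  intro d hd φ hqd l x y _ hyx hfree N hN n hn f hf
  have hP := φ.two_le_maxParam
  have hc := φ.two_le_maxConst
  have hdet := ModCount.determined_sat hP hc φ d (insert x (Finset.univ.image y)) hqd
    (fun v hv => by
      rcases hfree v hv with rfl | ⟨i, rfl⟩ <;> simp)
    (fun a ha => φ.isGreatest_maxParam.2 (Finset.mem_union_left _ ha))
    (fun k hk => by
      exact_mod_cast φ.isGreatest_maxParam.2
        (Finset.mem_union_right _ (Finset.mem_image_of_mem _ hk)))
    (fun a ha => φ.isGreatest_maxConst.2 ha)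
  have hper := hdet.eventuallyPeriodic (by simpa using hyx) (f := f) (N := N) (l := l)
    (by simpa [hf] using hn) (by simpa using Finset.card_image_le (s := Finset.univ) (f := y))
  have hD := ModCount.modulus_pos φ.maxParam d
  have hbound := ModCount.period_le_bound hP hd hc hN l
  refine ⟨hper.nonempty_iff hD hbound, ?_⟩
  rintro q p hp C rfl
  -- The bound for exponent `d` already suffices; `d + 1` only enlarges it.
  have hle := hbound.trans (ModCount.Formula.bound_mono (κ := 16) (by norm_num) d.le_succ N l)
  refine hper.finite_and_iff hD hle ?_ (· ≡ q [MOD p])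
  have := hc.trans (ModCount.le_constBound hP φ.maxConst d)
  omega
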